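/- For $v\in L^1(\mathbb R^2)$ let $\mathrm{TV}(v)\in[0,\infty]$ be the total mass of its distributional gradient, i.e. $\mathrm{TV}(v)=\sup\{\int_{\mathbb R^2} v\,\operatorname{div}p : p\in C^1_c(\mathbb R^2;\mathbb R^2),\ |p|\le 1\}$; let $\mathrm{BV}(\mathbb R^2)$ be the set of $v\in L^1(\mathbb R^2)$ with $\mathrm{TV}(v)<\infty$, and let $\operatorname{Per}(B)=\mathrm{TV}(1_B)$ for a measurable set $B$ of finite measure $|B|$. Let $\Omega_1\subset\Omega_0\subset\mathbb R^2$ be bounded (Lebesgue) measurable sets, and for $\nu\in\mathbb R$ put $$\mathcal A_\nu(\Omega_0,\Omega_1)=\Big\{v\in \mathrm{BV}(\mathbb R^2) : v=0 \text{ a.e. on } \mathbb R^2\setminus\Omega_0,\ v=1\text{ a.e. on }\Omega_1,\ \int_{\mathbb R^2} v=\nu\Big\}.$$ Call $s_0\in[0,1]$ a Lebesgue point of $f:[0,1]\to[0,\infty]$ if $f(s_0)<\infty$ and the mean value of $|f-f(s_0)|$ over $[s_0-h,s_0+h]\cap[0,1]$ tends to $0$ as $h\downarrow0$. Let $u$ be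 a minimizer of $\mathrm{TV}$ in $\mathcal A_\nu(\Omega_0,\Omega_1)$ with values in $[0,1]$ (almost everywhere), and write $E_s=\{u>s\}$ for $s\in[0,1]$. Then the functions $s\mapsto\operatorname{Per}(E_s)$ and $s\mapsto|E_s|$ are measurable on $[0,1]$, and almost every $s\in[0,1]$ is a Lebesgue point of both of them. Moreover, for every $s_0\in[0,1]$ that is a Lebesgue point of both functions, $1_{E_{s_0}}$ belongs to $\mathcal A_{|E_{s_0}|}(\Omega_0,\Omega_1)$ and minimizes $\mathrm{TV}$ in $\mathcal A_{|E_{s_0}|}(\Omega_0,\Omega_1)$. -/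

import Mathlib

open MeasureTheory Set Filter
open scoped Topology ENNReal

noncomputable section

namespace TVMin

/-- The Euclidean plane `ℝ²`, with its Lebesgue measure `volume`. -/
abbrev Plane : Type := EuclideanSpace ℝ (Fin 2)

/-- The divergence `∂₁ p₁ + ∂₂ p₂` of a vector field on the plane. -/
def divergence (p : Plane → Plane) (x : Plane) : ℝ :=
  ∑ i : Fin 2, fderiv ℝ p x (EuclideanSpace.single i 1) i

/-- Test fields: compactly supported `C¹` vector fields with `|p(x)| ≤ 1` for all `x`
(Euclidean norm). -/
def IsTestField (p : Plane → Plane) : Prop :=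
  ContDiff ℝ 1 p ∧ HasCompactSupport p ∧ ∀ x, ‖p x‖ ≤ 1

/-- The total variation `TV(v) ∈ [0, ∞]` of `v ∈ L¹(ℝ²)`: the mass of its distributional gradient,
`sup {∫ v div p : p a test field}`. It is finite exactly when the distributional gradient is a
Radon measure of finite mass. -/
def TV (v : Plane → ℝ) : ℝ≥0∞ :=
  ⨆ (p : Plane → Plane) (_ : IsTestField p), ENNReal.ofReal (∫ x, v x * divergence p x)

/-- The perimeter of a set: the total variation of its indicator function. -/
def perimeter (B : Set Plane) : ℝ≥0∞ :=
  TV (B.indicator 1)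

/-- `v ∈ BV(ℝ²)`. -/
def IsBV (v : Plane → ℝ) : Prop :=
  Integrable v ∧ TV v < ∞

/-- The class `A_ν(Ω₀, Ω₁)` of functions of bounded variation which vanish outside `Ω₀`, equal `1`
on `Ω₁` (both almost everywhere, as for elements of `L¹`) and have integral `ν`. -/
def admissible (Ω₀ Ω₁ : Set Plane) (ν : ℝ) : Set (Plane → ℝ) :=
  {v | IsBV v ∧ (∀ᵐ x, x ∉ Ω₀ → v x = 0) ∧ (∀ᵐ x, x ∈ Ω₁ → v x = 1) ∧ ∫ x, v x = ν}

/-- `u` minimizes `TV` in the class `S`. -/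
def MinimizesTV (S : Set (Plane → ℝ)) (u : Plane → ℝ) : Prop :=
  u ∈ S ∧ IsMinOn TV S u

/-- The level set `E_s = {u > s}`. -/
def levelSet (u : Plane → ℝ) (s : ℝ) : Set Plane :=
  {x | s < u x}

/-- `s₀` is a Lebesgue point of the function `f : [0,1] → [0,∞]`: the value `f(s₀)` is finite and the
mean of `|f - f(s₀)|` over `[s₀ - h, s₀ + h] ∩ [0,1]` tends to `0` as `h ↓ 0`. Subtraction in
`[0,∞]` is truncated, so that `(a - b) + (b - a)` is `|a - b|`. Only the values of `f` on `[0,1]`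
matter. -/
def IsLebesguePoint (f : ℝ → ℝ≥0∞) (s₀ : ℝ) : Prop :=
  s₀ ∈ Icc (0 : ℝ) 1 ∧ f s₀ ≠ ∞ ∧
    Tendsto
      (fun h : ℝ => ⨍⁻ s in Icc (s₀ - h) (s₀ + h) ∩ Icc (0 : ℝ) 1,
        ((f s - f s₀) + (f s₀ - f s)) ∂volume)
      (𝓝[>] 0) (𝓝 0)

end TVMin

end

open scoped Convolution

namespace TVMin

/-! The function `u` is the average of its layers: u = ∫₀¹ 1_{E_s} ds. Let v compete with
1_{E_{s₀}}, and let I be a small window of levels around s₀. Replacing the layers with s ∈ I by v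
gives ∫_{[0,1]∖I} 1_{E_s} ds + |I| v, which satisfies the constraints on Ω₀ and Ω₁ but may have the
wrong integral. A multiple c w of a fixed function w, vanishing off Ω₀ and on Ω₁ and with nonzero
integral, repairs this; w = 1_{E_t} - v will do for a level t with |E_t| ≠ |E_{s₀}|. If there is no
suitable t, almost all layers already have the right area and no repair is needed.

Minimality of `u`, the coarea inequality ∫₀¹ Per(E_s) ds ≤ TV(u)
(`lintegral_perimeter_levelSet_le_TV`) and convexity of TV (`TV_slab_le`) give, after cancelling the
layers outside I, ∫_I Per(E_s) ds ≤ |I| TV(v) + K ∫_I ||E_s| - |E_{s₀}|| ds, with K independent of I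
(`exists_lintegral_perimeter_le`). Dividing by |I| and shrinking I to the Lebesgue point s₀ yields
Per(E_{s₀}) ≤ TV(v).

For the coarea inequality, choose at each level s the best of finitely many test fields p_n. By
Fubini the resulting integral is Σ ∫ G_n(u) div p_n, where G_n(t) measures the levels below t at
which p_n is chosen. The increments of the G_n add up to at most those of the identity, so this sum
is at most TV(u) (`sum_integral_comp_le`): in the smooth case Σ G_n'(u) p_n is itself a test field,
and mollification gives the rest. -/

/-! ### Divergence and integration by parts. -/

theorem fderiv_apply_coord {p : Plane → Plane} {x : Plane} (hp : DifferentiableAt ℝ p x)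
    (v : Plane) (i : Fin 2) : fderiv ℝ p x v i = fderiv ℝ (fun y => p y i) x v := by
  have h := ((EuclideanSpace.proj i : Plane →L[ℝ] ℝ).hasFDerivAt
    (x := p x)).comp x hp.hasFDerivAt
  have h2 : HasFDerivAt (fun y => p y i)
    ((EuclideanSpace.proj i : Plane →L[ℝ] ℝ).comp (fderiv ℝ p x)) x := h
  rw [h2.fderiv]
  rfl

theorem contDiff_coord {p : Plane → Plane} (hp : ContDiff ℝ 1 p) (i : Fin 2) :
    ContDiff ℝ 1 (fun y => p y i) :=
  (EuclideanSpace.proj i : Plane →L[ℝ] ℝ).contDiff.comp hp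

theorem hasCompactSupport_coord {p : Plane → Plane} (hp : HasCompactSupport p) (i : Fin 2) :
    HasCompactSupport (fun y => p y i) :=
  hp.comp_left (g := fun z : Plane => z i) rfl

theorem continuous_divergence {p : Plane → Plane} (hp : ContDiff ℝ 1 p) :
    Continuous (divergence p) := by
  unfold divergence
  refine continuous_finsetSum _ fun i _ => ?_
  simp_rw [fun x => fderiv_apply_coord (hp.differentiable one_ne_zero x) (EuclideanSpace.single i 1) i]
  exact ((contDiff_coord hp i).continuous_fderiv one_ne_zero).clm_apply continuous_const

theorem hasCompactSupport_divergence {p : Plane → Plane} (hp : HasCompactSupport p) :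
    HasCompactSupport (divergence p) := by
  refine (hp.fderiv (𝕜 := ℝ)).mono fun x hx h0 => hx ?_
  simp only [divergence]
  simp [h0]

theorem integrable_divergence {p : Plane → Plane} (hp : ContDiff ℝ 1 p)
    (hc : HasCompactSupport p) : Integrable (divergence p) :=
  (continuous_divergence hp).integrable_of_hasCompactSupport (hasCompactSupport_divergence hc)

/-- Integration by parts of a `C¹` function against the divergence of a test field. -/
theorem integral_mul_divergence {f : Plane → ℝ} (hf : ContDiff ℝ 1 f) {p : Plane → Plane}
    (hp : ContDiff ℝ 1 p) (hc : HasCompactSupport p) :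
    ∫ x, f x * divergence p x = -∫ x, fderiv ℝ f x (p x) := by
  have hpi := fun i => contDiff_coord hp i
  have hci := fun i => hasCompactSupport_coord hc i
  have hfe : ∀ i : Fin 2, Continuous fun x => fderiv ℝ f x (EuclideanSpace.single i 1) := fun i =>
    (hf.continuous_fderiv one_ne_zero).clm_apply continuous_const
  have hpe : ∀ i : Fin 2,
      Continuous fun x => fderiv ℝ (fun y => p y i) x (EuclideanSpace.single i 1) := fun i =>
    ((hpi i).continuous_fderiv one_ne_zero).clm_apply continuous_const
  have hpec : ∀ i : Fin 2, HasCompactSupport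
      fun x => fderiv ℝ (fun y => p y i) x (EuclideanSpace.single i 1) := fun i =>
    ((hci i).fderiv (𝕜 := ℝ)).mono fun x hx h0 => hx (by simp [h0])
  have i1 : ∀ i : Fin 2, Integrable
      (fun x => fderiv ℝ f x (EuclideanSpace.single i 1) * p x i) := fun i =>
    ((hfe i).mul (hpi i).continuous).integrable_of_hasCompactSupport (hci i).mul_left
  have i2 : ∀ i : Fin 2, Integrable
      (fun x => f x * fderiv ℝ (fun y => p y i) x (EuclideanSpace.single i 1)) := fun i =>
    (hf.continuous.mul (hpe i)).integrable_of_hasCompactSupport (hpec i).mul_left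
  have i3 : ∀ i : Fin 2, Integrable (fun x => f x * p x i) := fun i =>
    (hf.continuous.mul (hpi i).continuous).integrable_of_hasCompactSupport (hci i).mul_left
  have key : ∀ i : Fin 2, ∫ x, f x * fderiv ℝ (fun y => p y i) x (EuclideanSpace.single i 1)
      = -∫ x, fderiv ℝ f x (EuclideanSpace.single i 1) * p x i := fun i =>
    integral_mul_fderiv_eq_neg_fderiv_mul_of_integrable (i1 i) (i2 i) (i3 i)
      (fun x _ => hf.differentiable one_ne_zero x)
      (fun x _ => (hpi i).differentiable one_ne_zero x)
  have e1 : ∀ x, f x * divergence p x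
      = ∑ i : Fin 2, f x * fderiv ℝ (fun y => p y i) x (EuclideanSpace.single i 1) := fun x => by
    simp only [divergence, Finset.mul_sum,
      fderiv_apply_coord (hp.differentiable one_ne_zero x)]
  have e2 : ∀ x, fderiv ℝ f x (p x)
      = ∑ i : Fin 2, fderiv ℝ f x (EuclideanSpace.single i 1) * p x i := fun x => by
    have : p x = ∑ i : Fin 2, p x i • EuclideanSpace.single i (1 : ℝ) := by
      ext j
      fin_cases j <;> simp
    conv_lhs => rw [this]
    simp [mul_comm]
  simp_rw [e1, e2]
  rw [integral_finsetSum _ fun i _ => i2 i, integral_finsetSum _ fun i _ => i1 i,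
    ← Finset.sum_neg_distrib]
  exact Finset.sum_congr rfl fun i _ => key i

/-! ### Compositions with monotone functions: the smooth case. -/

theorem IsTestField.le_TV {p : Plane → Plane} (hp : IsTestField p) (v : Plane → ℝ) :
    ENNReal.ofReal (∫ x, v x * divergence p x) ≤ TV v :=
  le_iSup₂ (f := fun (p : Plane → Plane) (_ : IsTestField p) =>
    ENNReal.ofReal (∫ x, v x * divergence p x)) p hp

theorem IsTestField.integrable {p : Plane → Plane} (hp : IsTestField p) :
    Integrable (divergence p) := integrable_divergence hp.1 hp.2.1

/-- The weights G_n'(f) are nonnegative with sum at most 1, so q = Σ G_n'(f) p_n is again a test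
field. By the chain rule and integration by parts in both directions, testing f against q gives the
left-hand side. -/
theorem sum_integral_comp_le_of_contDiff {ι : Type*} (s : Finset ι) {f : Plane → ℝ}
    (hf : ContDiff ℝ 1 f) {G : ι → ℝ → ℝ} (hG : ∀ n ∈ s, ContDiff ℝ 2 (G n))
    (h0 : ∀ n ∈ s, ∀ t, 0 ≤ deriv (G n) t) (h1 : ∀ t, ∑ n ∈ s, deriv (G n) t ≤ 1)
    {p : ι → Plane → Plane} (hp : ∀ n ∈ s, IsTestField (p n)) :
    ENNReal.ofReal (∑ n ∈ s, ∫ x, G n (f x) * divergence (p n) x) ≤ TV f := by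
  have hg : ∀ n ∈ s, ContDiff ℝ 1 (deriv (G n)) := fun n hn =>
    (contDiff_succ_iff_deriv.1 (by rw [one_add_one_eq_two]; exact hG n hn :
      ContDiff ℝ (1 + 1) (G n))).2.2
  set q : Plane → Plane := fun x => ∑ n ∈ s, deriv (G n) (f x) • p n x with hq
  have hqn : ∀ n ∈ s, HasCompactSupport fun x => deriv (G n) (f x) • p n x := fun n hn =>
    (hp n hn).2.1.mono fun x hx h0 => hx (by simp [h0])
  have hq1 : ContDiff ℝ 1 q :=
    ContDiff.sum fun n hn => ((hg n hn).comp hf).smul (hp n hn).1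
  have hqc : HasCompactSupport q := by
    refine HasCompactSupport.intro (K := ⋃ n ∈ s, tsupport (p n))
      (s.isCompact_biUnion fun n hn => (hp n hn).2.1) fun x hx => ?_
    refine Finset.sum_eq_zero fun n hn => ?_
    rw [image_eq_zero_of_notMem_tsupport (f := p n) (fun h => hx (mem_biUnion hn h)), smul_zero]
  have hqt : IsTestField q := by
    refine ⟨hq1, hqc, fun x => (norm_sum_le _ _).trans (le_trans (Finset.sum_le_sum fun n hn => ?_) (h1 (f x)))⟩
    rw [norm_smul, Real.norm_of_nonneg (h0 n hn _)]
    exact mul_le_of_le_one_right (h0 n hn _) ((hp n hn).2.2 x)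
  refine le_trans (le_of_eq ?_) (hqt.le_TV f)
  congr 1
  rw [integral_mul_divergence hf hq1 hqc]
  have hfd : Continuous (fderiv ℝ f) := hf.continuous_fderiv one_ne_zero
  have : ∀ x, fderiv ℝ f x (q x) = ∑ n ∈ s, fderiv ℝ f x (deriv (G n) (f x) • p n x) := fun x => by
    simp only [hq, map_sum]
  simp_rw [this]
  rw [integral_finsetSum, ← Finset.sum_neg_distrib]
  · refine Finset.sum_congr rfl fun n hn => ?_
    have hGn : ContDiff ℝ 1 (G n) := (hG n hn).of_le (by norm_num)
    have := integral_mul_divergence (hGn.comp hf) (hp n hn).1 (hp n hn).2.1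
    simp only [Function.comp_apply] at this
    rw [this]
    congr 1
    refine integral_congr_ae (Eventually.of_forall fun x => ?_)
    have hd : HasFDerivAt (G n ∘ f) (deriv (G n) (f x) • fderiv ℝ f x) x :=
      (hGn.differentiable one_ne_zero (f x)).hasDerivAt.comp_hasFDerivAt x
        (hf.differentiable one_ne_zero x).hasFDerivAt
    simp only [hd.fderiv]
    simp
  · intro n hn
    refine (hfd.clm_apply (((hg n hn).continuous.comp hf.continuous).smul
      (hp n hn).1.continuous)).integrable_of_hasCompactSupport ?_
    exact (hp n hn).2.1.mono fun x hx h0 => hx (by simp [h0])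

theorem IsTestField.comp_add_right {p : Plane → Plane} (hp : IsTestField p) (t : Plane) :
    IsTestField fun x => p (x + t) :=
  ⟨hp.1.comp (contDiff_id.add contDiff_const), hp.2.1.comp_homeomorph (Homeomorph.addRight t),
    fun x => hp.2.2 (x + t)⟩

theorem divergence_comp_add_right (p : Plane → Plane) (t x : Plane) :
    divergence (fun y => p (y + t)) x = divergence p (x + t) := by
  simp [divergence, fderiv_comp_add_right]

/-- Pairing the convolution with p amounts to averaging the pairings of u with the translates of p,
which are test fields too. -/
theorem TV_convolution_le (φ : ContDiffBump (0 : Plane)) {u : Plane → ℝ} (hu : Measurable u)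
    (hu01 : ∀ x, u x ∈ Icc (0 : ℝ) 1) :
    TV (φ.normed volume ⋆[ContinuousLinearMap.lsmul ℝ ℝ, volume] u) ≤ TV u := by
  refine iSup₂_le fun p hp => ?_
  by_cases htop : TV u = ∞
  · rw [htop]; exact le_top
  refine ENNReal.ofReal_le_of_le_toReal ?_
  have hint : Integrable (fun z : Plane × Plane =>
      u (z.1 - z.2) * (divergence p z.1 * φ.normed volume z.2)) (volume.prod volume) := by
    refine (hp.integrable.mul_prod φ.integrable_normed).bdd_mul (c := 1)
      (hu.comp (measurable_fst.sub measurable_snd)).aestronglyMeasurable ?_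
    exact Eventually.of_forall fun z => by
      rw [Real.norm_of_nonneg (hu01 _).1]; exact (hu01 _).2
  have hswap : ∫ x, (φ.normed volume ⋆[ContinuousLinearMap.lsmul ℝ ℝ, volume] u) x * divergence p x
      = ∫ t, φ.normed volume t * ∫ x, u x * divergence (fun y => p (y + t)) x := by
    have h1 : ∀ x, (φ.normed volume ⋆[ContinuousLinearMap.lsmul ℝ ℝ, volume] u) x * divergence p x
        = ∫ t, u (x - t) * (divergence p x * φ.normed volume t) := fun x => by
      rw [convolution_def, ← integral_mul_const]
      refine integral_congr_ae (Eventually.of_forall fun t => ?_)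
      simp only [ContinuousLinearMap.lsmul_apply, smul_eq_mul]
      ring
    simp_rw [h1]
    rw [integral_integral_swap hint]
    refine integral_congr_ae (Eventually.of_forall fun t => ?_)
    simp only [divergence_comp_add_right]
    rw [← integral_const_mul, ← integral_add_right_eq_self _ t]
    refine integral_congr_ae (Eventually.of_forall fun x => ?_)
    simp only [add_sub_cancel_right]
    ring
  rw [hswap]
  have hle : ∀ t, φ.normed volume t * ∫ x, u x * divergence (fun y => p (y + t)) x
      ≤ φ.normed volume t * (TV u).toReal := fun t =>
    mul_le_mul_of_nonneg_left
      ((ENNReal.ofReal_le_iff_le_toReal htop).1 ((hp.comp_add_right t).le_TV u))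
      (φ.nonneg_normed t)
  by_cases hi : Integrable fun t => φ.normed volume t *
      ∫ x, u x * divergence (fun y => p (y + t)) x
  · refine (integral_mono hi (φ.integrable_normed.mul_const _) hle).trans ?_
    rw [integral_mul_const, φ.integral_normed, one_mul]
  -- Without integrability the integral has the default value 0, so the bound still holds.
  · rw [integral_undef hi]; exact ENNReal.toReal_nonneg

/-! ### Mollification, on the plane for u and on the line for the G_n. -/

section Mollify

variable {V : Type*} [NormedAddCommGroup V] [InnerProductSpace ℝ V] [FiniteDimensional ℝ V]
  [MeasurableSpace V] [BorelSpace V]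

/-- A sequence of bump functions whose supports shrink to the origin. -/
noncomputable def bump (V : Type*) [NormedAddCommGroup V] [InnerProductSpace ℝ V] (k : ℕ) :
    ContDiffBump (0 : V) where
  rIn := 1 / (k + 1)
  rOut := 2 / (k + 1)
  rIn_pos := by positivity
  rIn_lt_rOut := by gcongr; norm_num

/-- Convolution with a bump function. -/
noncomputable def mollify (k : ℕ) (f : V → ℝ) : V → ℝ :=
  (bump V k).normed volume ⋆[ContinuousLinearMap.lsmul ℝ ℝ, volume] f

theorem mollify_apply (k : ℕ) (f : V → ℝ) (x : V) :
    mollify k f x = ∫ t, (bump V k).normed volume t * f (x - t) := rfl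

theorem locallyIntegrable_of_mem_Icc {f : V → ℝ} (hf : Measurable f)
    (h01 : ∀ x, f x ∈ Icc (0 : ℝ) 1) : LocallyIntegrable f := by
  refine (locallyIntegrable_const (1 : ℝ)).mono hf.aestronglyMeasurable
    (Eventually.of_forall fun x => ?_)
  rw [Real.norm_of_nonneg (h01 x).1, norm_one]
  exact (h01 x).2

theorem integrable_bump_mul (k : ℕ) {f : V → ℝ} (hf : Measurable f)
    (h01 : ∀ x, f x ∈ Icc (0 : ℝ) 1) (x : V) :
    Integrable fun t => (bump V k).normed volume t * f (x - t) :=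
  (bump V k).integrable_normed.mul_bdd (c := 1)
    (hf.comp (measurable_const.sub measurable_id)).aestronglyMeasurable
    (Eventually.of_forall fun t => by
      rw [Real.norm_of_nonneg (h01 _).1]; exact (h01 _).2)

theorem contDiff_mollify (k : ℕ) {f : V → ℝ} (hf : Measurable f)
    (h01 : ∀ x, f x ∈ Icc (0 : ℝ) 1) (n : ℕ) : ContDiff ℝ n (mollify k f) :=
  (bump V k).hasCompactSupport_normed.contDiff_convolution_left _ (bump V k).contDiff_normed
    (locallyIntegrable_of_mem_Icc hf h01)

theorem mollify_mem_Icc (k : ℕ) {f : V → ℝ} (hf : Measurable f)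
    (h01 : ∀ x, f x ∈ Icc (0 : ℝ) 1) (x : V) : mollify k f x ∈ Icc (0 : ℝ) 1 := by
  rw [mollify_apply]
  have h0 := (bump V k).nonneg_normed (μ := volume)
  refine ⟨integral_nonneg fun t => mul_nonneg (h0 t) (h01 _).1, ?_⟩
  rw [← (bump V k).integral_normed (μ := volume)]
  exact integral_mono (integrable_bump_mul k hf h01 x) (bump V k).integrable_normed
    fun t => mul_le_of_le_one_right (h0 t) (h01 _).2

omit [FiniteDimensional ℝ V] [MeasurableSpace V] [BorelSpace V] in
theorem tendsto_bump_rOut : Tendsto (fun k => (bump V k).rOut) atTop (𝓝 0) := by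
  have := (tendsto_one_div_add_atTop_nhds_zero_nat (𝕜 := ℝ)).const_mul 2
  simpa [bump, div_eq_mul_inv] using this

theorem ae_tendsto_mollify {f : V → ℝ} (hf : Measurable f) (h01 : ∀ x, f x ∈ Icc (0 : ℝ) 1) :
    ∀ᵐ x, Tendsto (fun k => mollify k f x) atTop (𝓝 (f x)) :=
  -- The constant 2 is the fixed ratio of the outer to the inner radius of the bumps.
  ContDiffBump.ae_convolution_tendsto_right_of_locallyIntegrable (K := 2) tendsto_bump_rOut
    (Eventually.of_forall fun k => by simp [bump, div_eq_mul_inv])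
    (locallyIntegrable_of_mem_Icc hf h01)

end Mollify

theorem tendsto_sum_integral_mul {ι : Type*} (s : Finset ι) {h : ι → Plane → ℝ}
    (hh : ∀ n ∈ s, Integrable (h n)) {F : ℕ → ι → Plane → ℝ} {F₀ : ι → Plane → ℝ}
    (hF : ∀ k, ∀ n ∈ s, Measurable (F k n)) (h01 : ∀ k, ∀ n ∈ s, ∀ x, F k n x ∈ Icc (0 : ℝ) 1)
    (hlim : ∀ n ∈ s, ∀ᵐ x, Tendsto (fun k => F k n x) atTop (𝓝 (F₀ n x))) :
    Tendsto (fun k => ENNReal.ofReal (∑ n ∈ s, ∫ x, F k n x * h n x)) atTop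
      (𝓝 (ENNReal.ofReal (∑ n ∈ s, ∫ x, F₀ n x * h n x))) := by
  refine ENNReal.tendsto_ofReal (tendsto_finsetSum _ fun n hn => ?_)
  refine tendsto_integral_of_dominated_convergence (fun x => ‖h n x‖)
    (fun k => (hF k n hn).aestronglyMeasurable.mul (hh n hn).1) (hh n hn).norm
    (fun k => Eventually.of_forall fun x => ?_) ?_
  · rw [norm_mul, Real.norm_of_nonneg (h01 k n hn x).1]
    exact mul_le_of_le_one_left (norm_nonneg _) (h01 k n hn x).2
  · filter_upwards [hlim n hn] with x hx using hx.mul_const _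

/-- Mollifying u reduces this to smooth functions: mollification does not increase TV, and the
left-hand side passes to the limit by dominated convergence. -/
theorem sum_integral_comp_le_of_smooth {ι : Type*} (s : Finset ι) {u : Plane → ℝ}
    (hu : Measurable u) (hu01 : ∀ x, u x ∈ Icc (0 : ℝ) 1) {G : ι → ℝ → ℝ}
    (hG : ∀ n ∈ s, ContDiff ℝ 2 (G n)) (hG01 : ∀ n ∈ s, ∀ t, G n t ∈ Icc (0 : ℝ) 1)
    (h0 : ∀ n ∈ s, ∀ t, 0 ≤ deriv (G n) t) (h1 : ∀ t, ∑ n ∈ s, deriv (G n) t ≤ 1)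
    {p : ι → Plane → Plane} (hp : ∀ n ∈ s, IsTestField (p n)) :
    ENNReal.ofReal (∑ n ∈ s, ∫ x, G n (u x) * divergence (p n) x) ≤ TV u := by
  have hlim := tendsto_sum_integral_mul s (h := fun n => divergence (p n))
    (F := fun k n x => G n (mollify k u x)) (F₀ := fun n x => G n (u x))
    (fun n hn => (hp n hn).integrable)
    (fun k n hn => ((hG n hn).continuous.comp (contDiff_mollify k hu hu01 0).continuous).measurable)
    (fun k n hn x => hG01 n hn _)
    (fun n hn => by
      filter_upwards [ae_tendsto_mollify hu hu01] with x hx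
      exact ((hG n hn).continuous.tendsto _).comp hx)
  refine le_of_tendsto' hlim fun k => ?_
  exact (sum_integral_comp_le_of_contDiff s (contDiff_mollify k hu hu01 1) hG h0 h1 hp).trans
    (TV_convolution_le (bump Plane k) hu hu01)

/-- For `[0,1]`-valued `u` and nondecreasing continuous `Gₙ` whose increments sum up to at most
those of the identity, the sum of the variations of `Gₙ ∘ u` is at most that of `u`. -/
theorem sum_integral_comp_le {ι : Type*} (s : Finset ι) {u : Plane → ℝ}
    (hu : Measurable u) (hu01 : ∀ x, u x ∈ Icc (0 : ℝ) 1) {G : ι → ℝ → ℝ}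
    (hG : ∀ n ∈ s, Continuous (G n)) (hG01 : ∀ n ∈ s, ∀ t, G n t ∈ Icc (0 : ℝ) 1)
    (h0 : ∀ n ∈ s, Monotone (G n)) (h1 : Monotone fun t => t - ∑ n ∈ s, G n t)
    {p : ι → Plane → Plane} (hp : ∀ n ∈ s, IsTestField (p n)) :
    ENNReal.ofReal (∑ n ∈ s, ∫ x, G n (u x) * divergence (p n) x) ≤ TV u := by
  have hGm : ∀ n ∈ s, Measurable (G n) := fun n hn => (hG n hn).measurable
  have hd : ∀ k, ∀ n ∈ s, Differentiable ℝ (mollify k (G n)) := fun k n hn =>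
    (contDiff_mollify k (hGm n hn) (hG01 n hn) 1).differentiable one_ne_zero
  have hlim := tendsto_sum_integral_mul s (h := fun n => divergence (p n))
    (F := fun k n x => mollify k (G n) (u x)) (F₀ := fun n x => G n (u x))
    (fun n hn => (hp n hn).integrable)
    (fun k n hn => (contDiff_mollify k (hGm n hn) (hG01 n hn) 0).continuous.measurable.comp hu)
    (fun k n hn x => mollify_mem_Icc k (hGm n hn) (hG01 n hn) _)
    (fun n hn => Eventually.of_forall fun x =>
      ContDiffBump.convolution_tendsto_right_of_continuous tendsto_bump_rOut (hG n hn) (u x))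
  refine le_of_tendsto' hlim fun k => ?_
  refine sum_integral_comp_le_of_smooth s hu hu01
    (fun n hn => contDiff_mollify k (hGm n hn) (hG01 n hn) 2)
    (fun n hn => mollify_mem_Icc k (hGm n hn) (hG01 n hn)) ?_ ?_ hp
  · intro n hn t
    refine Monotone.deriv_nonneg (fun a b hab => ?_)
    simp only [mollify_apply]
    exact integral_mono (integrable_bump_mul k (hGm n hn) (hG01 n hn) a)
      (integrable_bump_mul k (hGm n hn) (hG01 n hn) b) fun r =>
      mul_le_mul_of_nonneg_left (h0 n hn (by linarith)) ((bump ℝ k).nonneg_normed r)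
  · intro t
    -- The bump has mass one, so averaging over translates preserves the bound b - a on the total
    -- increment. The derivatives therefore sum to at most 1.
    have hmono : Monotone fun t => t - ∑ n ∈ s, mollify k (G n) t := by
      intro a b hab
      have e : ∀ c, ∑ n ∈ s, mollify k (G n) c
          = ∫ r, ∑ n ∈ s, (bump ℝ k).normed volume r * G n (c - r) := fun c => by
        rw [integral_finsetSum _ fun n hn => integrable_bump_mul k (hGm n hn) (hG01 n hn) c]
        rfl
      have hi : ∀ c, Integrable fun r => ∑ n ∈ s, (bump ℝ k).normed volume r * G n (c - r) :=
        fun c => integrable_finsetSum _ fun n hn =>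
          integrable_bump_mul k (hGm n hn) (hG01 n hn) c
      have hb : ∫ r, (bump ℝ k).normed volume r * (b - a) = b - a := by
        rw [integral_mul_const, (bump ℝ k).integral_normed, one_mul]
      have : ∫ r, ∑ n ∈ s, (bump ℝ k).normed volume r * G n (b - r)
          ≤ ∫ r, (∑ n ∈ s, (bump ℝ k).normed volume r * G n (a - r)
            + (bump ℝ k).normed volume r * (b - a)) := by
        refine integral_mono (hi b) ((hi a).add ((bump ℝ k).integrable_normed.mul_const _))
          fun r => ?_
        simp only [← Finset.mul_sum, ← mul_add]
        refine mul_le_mul_of_nonneg_left ?_ ((bump ℝ k).nonneg_normed r)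
        have := h1 (show a - r ≤ b - r by linarith)
        simp only at this
        linarith
      rw [integral_add (hi a) ((bump ℝ k).integrable_normed.mul_const _), hb] at this
      simp only [e]
      linarith
    have h := hmono.deriv_nonneg (x := t)
    rw [deriv_fun_sub differentiableAt_fun_id (DifferentiableAt.fun_sum fun n hn => hd k n hn t),
      deriv_fun_sum fun n hn => hd k n hn t, deriv_id''] at h
    linarith

/-! ### Elementary properties of the total variation. -/

theorem TV_congr_ae {f g : Plane → ℝ} (h : f =ᵐ[volume] g) : TV f = TV g := by
  unfold TV
  have (p : Plane → Plane) : ∫ x, f x * divergence p x = ∫ x, g x * divergence p x :=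
    integral_congr_ae (h.mul .rfl)
  simp_rw [this]

theorem perimeter_congr_ae {A B : Set Plane} (h : A =ᵐ[volume] B) : perimeter A = perimeter B :=
  TV_congr_ae (indicator_ae_eq_of_ae_eq_set h)

theorem IsTestField.integrable_mul {p : Plane → Plane} (hp : IsTestField p) {f : Plane → ℝ}
    (hf : Integrable f) : Integrable fun x => f x * divergence p x := by
  obtain ⟨C, hC⟩ := (hasCompactSupport_divergence hp.2.1).exists_bound_of_continuous
    (continuous_divergence hp.1)
  exact hf.mul_bdd (continuous_divergence hp.1).aestronglyMeasurable (Eventually.of_forall hC)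

theorem IsTestField.neg {p : Plane → Plane} (hp : IsTestField p) : IsTestField (-p) :=
  ⟨hp.1.neg, hp.2.1.neg, fun x => by simpa using hp.2.2 x⟩

theorem divergence_neg (p : Plane → Plane) (x : Plane) : divergence (-p) x = -divergence p x := by
  simp [divergence, fderiv_neg, add_comm]

theorem isTestField_zero : IsTestField 0 :=
  ⟨contDiff_const, HasCompactSupport.zero, fun x => by simp⟩

theorem divergence_zero (x : Plane) : divergence 0 x = 0 := by
  have h : fderiv ℝ (0 : Plane → Plane) x = 0 := by
    rw [show (0 : Plane → Plane) = fun _ => 0 from rfl, fderiv_fun_const]; rfl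
  simp [divergence, h]

theorem TV_add_le {f g : Plane → ℝ} (hf : Integrable f) (hg : Integrable g) :
    TV (fun x => f x + g x) ≤ TV f + TV g := by
  refine iSup₂_le fun p hp => ?_
  simp only [add_mul]
  rw [integral_add (hp.integrable_mul hf) (hp.integrable_mul hg)]
  exact ENNReal.ofReal_add_le.trans (add_le_add (hp.le_TV f) (hp.le_TV g))

theorem TV_const_mul_le (c : ℝ) (f : Plane → ℝ) :
    TV (fun x => c * f x) ≤ ENNReal.ofReal |c| * TV f := by
  refine iSup₂_le fun p hp => ?_
  simp only [mul_assoc]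
  rw [integral_const_mul]
  rcases le_total 0 c with hc | hc
  · rw [abs_of_nonneg hc, ENNReal.ofReal_mul hc]
    gcongr
    exact hp.le_TV f
  · have := hp.neg.le_TV f
    simp only [divergence_neg, mul_neg, integral_neg] at this
    rw [abs_of_nonpos hc, ← neg_mul_neg, ENNReal.ofReal_mul (by linarith)]
    gcongr

/-! ### Perimeters, level sets and layers. -/

theorem integral_indicator_one_mul {E : Set Plane} (hE : NullMeasurableSet E)
    (h : Plane → ℝ) : ∫ x, E.indicator 1 x * h x = ∫ x in E, h x := by
  rw [← integral_indicator₀ hE]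
  refine integral_congr_ae (Eventually.of_forall fun x => ?_)
  by_cases hx : x ∈ E <;> simp [hx]

/-- Perimeters are computed by a single sequence of test fields. -/
theorem exists_seq_perimeter_eq : ∃ p : ℕ → Plane → Plane, (∀ n, IsTestField (p n)) ∧ p 0 = 0 ∧
    ∀ E : Set Plane, MeasurableSet E →
      perimeter E = ⨆ n, ENNReal.ofReal (∫ x in E, divergence (p n) x) := by
  -- L¹ is separable, so some sequence of divergences is dense among all divergences of test fields;
  -- f ↦ ∫_E f is continuous on L¹.
  let T : {q : Plane → Plane // IsTestField q} → (Plane →₁[volume] ℝ) :=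
    fun q => q.2.integrable.toL1 _
  have : Fact ((1 : ℝ≥0∞) ≠ ∞) := ⟨ENNReal.one_ne_top⟩
  have : Nonempty (range T) := ⟨⟨T ⟨0, isTestField_zero⟩, mem_range_self _⟩⟩
  let D : ℕ → range T := TopologicalSpace.denseSeq (range T)
  have hD : DenseRange D := TopologicalSpace.denseRange_denseSeq _
  choose q hq using fun n => (D n).2
  -- Index 0 is reserved for the zero field, which keeps maxima over n ≤ N nonnegative.
  refine ⟨fun n => Nat.casesOn n 0 fun m => (q m).1, fun n => ?_, rfl, fun E hE => ?_⟩
  · cases n with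
    | zero => exact isTestField_zero
    | succ m => exact (q m).2
  have hT : ∀ r, ∫ x in E, T r x = ∫ x in E, divergence r.1 x := fun r =>
    integral_congr_ae (ae_restrict_of_ae (Integrable.coeFn_toL1 _))
  refine le_antisymm (iSup₂_le fun r hr => ?_) (iSup_le fun n => ?_)
  · rw [integral_indicator_one_mul hE.nullMeasurableSet, ← hT ⟨r, hr⟩]
    have hcl : IsClosed {f : range T | ENNReal.ofReal (∫ x in E, (f : Plane →₁[volume] ℝ) x) ≤
        ⨆ n : ℕ, ENNReal.ofReal (∫ x in E, divergence
          (Nat.casesOn n 0 fun m => (q m).1 : Plane → Plane) x)} :=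
      isClosed_le (ENNReal.continuous_ofReal.comp
        ((continuous_setIntegral E).comp continuous_subtype_val)) continuous_const
    refine isClosed_property hD hcl (fun n => ?_) ⟨T ⟨r, hr⟩, mem_range_self _⟩
    rw [← hq n, hT]
    exact le_iSup (fun n : ℕ => ENNReal.ofReal (∫ x in E, divergence
          (Nat.casesOn n 0 fun m => (q m).1 : Plane → Plane) x)) (n + 1)
  · rw [← integral_indicator_one_mul hE.nullMeasurableSet]
    refine IsTestField.le_TV ?_ _
    cases n with
    | zero => exact isTestField_zero
    | succ m => exact (q m).2

theorem measurableSet_levelSet {u : Plane → ℝ} (hu : Measurable u) (s : ℝ) :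
    MeasurableSet (levelSet u s) := measurableSet_lt measurable_const hu

theorem measurableSet_subgraph {u : Plane → ℝ} (hu : Measurable u) :
    MeasurableSet {z : ℝ × Plane | z.1 < u z.2} :=
  measurableSet_lt measurable_fst (hu.comp measurable_snd)

theorem measurable_setIntegral_levelSet {u : Plane → ℝ} (hu : Measurable u) {h : Plane → ℝ}
    (hh : Measurable h) : Measurable fun s => ∫ x in levelSet u s, h x := by
  have : StronglyMeasurable ({z : ℝ × Plane | z.1 < u z.2}.indicator fun z => h z.2) :=
    ((hh.comp measurable_snd).indicator (measurableSet_subgraph hu)).stronglyMeasurable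
  have h2 := (this.integral_prod_right' (ν := (volume : Measure Plane))).measurable
  convert h2 using 2 with s
  rw [← integral_indicator (measurableSet_levelSet hu s)]
  rfl

theorem abs_setIntegral_levelSet_le {h : Plane → ℝ} (hh : Integrable h) (E : Set Plane) :
    |∫ x in E, h x| ≤ ∫ x, |h x| :=
  abs_integral_le_integral_abs.trans
    (setIntegral_le_integral hh.abs (Eventually.of_forall fun _ => abs_nonneg _))

theorem integrable_setIntegral_levelSet {u : Plane → ℝ} (hu : Measurable u) {h : Plane → ℝ}
    (hh : Measurable h) (hi : Integrable h) {J : Set ℝ} (hJ : volume J ≠ ∞) :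
    IntegrableOn (fun s => ∫ x in levelSet u s, h x) J := by
  have : IsFiniteMeasure (volume.restrict J) := ⟨by simpa using hJ.lt_top⟩
  exact Integrable.of_bound (measurable_setIntegral_levelSet hu hh).aestronglyMeasurable
    (∫ x, |h x|) (Eventually.of_forall fun s => abs_setIntegral_levelSet_le hi _)

/-- The part of `u` lying between levels in `J`: it equals `∫_J 1_{u > s} ds`. -/
noncomputable def slab (u : Plane → ℝ) (J : Set ℝ) (x : Plane) : ℝ :=
  volume.real (J ∩ Iio (u x))

/-- Fubini on the subgraph of u: for fixed x, the levels s ∈ J with s < u x have total length `slab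
u J x`. -/
theorem integral_slab_mul {u : Plane → ℝ} (hu : Measurable u) {J : Set ℝ}
    (hJf : volume J ≠ ∞) {h : Plane → ℝ} (hi : Integrable h) :
    ∫ x, slab u J x * h x = ∫ s in J, ∫ x in levelSet u s, h x := by
  have : IsFiniteMeasure (volume.restrict J) := ⟨by simpa using hJf.lt_top⟩
  have hint : Integrable ({z : ℝ × Plane | z.1 < u z.2}.indicator fun z => h z.2)
      ((volume.restrict J).prod volume) :=
    (hi.comp_snd (volume.restrict J)).indicator (measurableSet_subgraph hu)
  have e1 : ∀ s, ∫ x in levelSet u s, h x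
      = ∫ x, ({z : ℝ × Plane | z.1 < u z.2}.indicator fun z => h z.2) (s, x) := fun s => by
    rw [← integral_indicator (measurableSet_levelSet hu s)]
    rfl
  simp_rw [e1]
  rw [integral_integral_swap (f := fun s x =>
    ({z : ℝ × Plane | z.1 < u z.2}.indicator fun z => h z.2) (s, x)) hint]
  refine integral_congr_ae (Eventually.of_forall fun x => ?_)
  have : ∀ s, ({z : ℝ × Plane | z.1 < u z.2}.indicator fun z => h z.2) (s, x)
      = (Iio (u x)).indicator (fun _ => h x) s := fun s => rfl
  simp only [this]
  rw [integral_indicator measurableSet_Iio, setIntegral_const, smul_eq_mul, slab,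
    measureReal_restrict_apply measurableSet_Iio, inter_comm]

theorem measureReal_inter_Iio_le {A : Set ℝ} (hA : volume A ≠ ∞) {a b : ℝ} (hab : a ≤ b) :
    volume.real (A ∩ Iio b) ≤ volume.real (A ∩ Iio a) + (b - a) := by
  have hsub : A ∩ Iio b ⊆ (A ∩ Iio a) ∪ Ico a b := fun x hx => by
    rcases lt_or_ge x a with h | h
    · exact Or.inl ⟨hx.1, h⟩
    · exact Or.inr ⟨h, hx.2⟩
  have hf : volume (A ∩ Iio a) ≠ ∞ := measure_ne_top_of_subset inter_subset_left hA
  refine (measureReal_mono hsub (measure_union_ne_top hf (by simp))).trans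
    ((measureReal_union_le _ _).trans ?_)
  rw [Real.volume_real_Ico_of_le hab]

theorem monotone_measureReal_inter_Iio {A : Set ℝ} (hA : volume A ≠ ∞) :
    Monotone fun t => volume.real (A ∩ Iio t) := fun _ _ h =>
  measureReal_mono (inter_subset_inter_right _ (Iio_subset_Iio h))
    (measure_ne_top_of_subset inter_subset_left hA)

theorem continuous_measureReal_inter_Iio {A : Set ℝ} (hA : volume A ≠ ∞) :
    Continuous fun t => volume.real (A ∩ Iio t) := by
  refine (LipschitzWith.of_le_add fun b a => ?_).continuous
  rcases le_total a b with h | h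
  · rw [Real.dist_eq, abs_of_nonneg (by linarith)]
    exact measureReal_inter_Iio_le hA h
  · exact (monotone_measureReal_inter_Iio hA h).trans (by simp)

theorem measurable_slab {u : Plane → ℝ} (hu : Measurable u) {J : Set ℝ} (hJ : volume J ≠ ∞) :
    Measurable (slab u J) := (continuous_measureReal_inter_Iio hJ).measurable.comp hu

/-! ### The coarea inequality. -/

theorem exists_measurable_argmax {F : ℕ → ℝ → ℝ} (hF : ∀ n, Measurable (F n)) (N : ℕ) :
    ∃ e : ℝ → ℕ, Measurable e ∧ (∀ s, e s ≤ N) ∧ ∀ s, ∀ n ≤ N, F n s ≤ F (e s) s := by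
  induction N with
  | zero => exact ⟨fun _ => 0, measurable_const, fun _ => le_rfl, fun s n hn => by
      rw [Nat.le_zero.1 hn]⟩
  | succ N ih =>
    obtain ⟨e, he, heN, hmax⟩ := ih
    have hFe : Measurable fun s => F (e s) s :=
      (measurable_from_prod_countable_right (f := fun z : ℕ × ℝ => F z.1 z.2) hF).comp
        (he.prodMk measurable_id)
    classical
    refine ⟨fun s => if F (e s) s ≤ F (N + 1) s then N + 1 else e s,
      Measurable.ite (measurableSet_le hFe (hF _)) measurable_const he, fun s => ?_,
      fun s n hn => ?_⟩
    · dsimp only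
      split_ifs
      · exact le_rfl
      · exact (heN s).trans (Nat.le_succ N)
    · dsimp only
      split_ifs with h
      · rcases hn.lt_or_eq with h' | rfl
        · exact (hmax s n (Nat.lt_succ_iff.1 h')).trans h
        · exact le_rfl
      · rcases hn.lt_or_eq with h' | rfl
        · exact hmax s n (Nat.lt_succ_iff.1 h')
        · exact (not_le.1 h).le

/-- Splitting the levels according to the value of e turns the double integral into Σ ∫ G_n(u) div
p_n, with G_n(t) the measure of {s ∈ [0,1] : e s = n, s < t}. -/
theorem integral_selection_le_TV {u : Plane → ℝ} (hu : Measurable u)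
    (hu01 : ∀ x, u x ∈ Icc (0 : ℝ) 1) {p : ℕ → Plane → Plane} (hp : ∀ n, IsTestField (p n))
    {e : ℝ → ℕ} (he : Measurable e) {N : ℕ} (heN : ∀ s, e s ≤ N) :
    ENNReal.ofReal (∫ s in Icc (0 : ℝ) 1, ∫ x in levelSet u s, divergence (p (e s)) x) ≤ TV u := by
  have hfin : ∀ n, volume (Icc (0 : ℝ) 1 ∩ e ⁻¹' {n}) ≠ ∞ := fun n =>
    measure_ne_top_of_subset inter_subset_left (by simp)
  have hme : ∀ n, MeasurableSet (e ⁻¹' {n}) := fun n => he (measurableSet_singleton n)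
  have hFi : ∀ n, IntegrableOn (fun s => ∫ x in levelSet u s, divergence (p n) x) (Icc 0 1) :=
    fun n => integrable_setIntegral_levelSet hu (continuous_divergence (hp n).1).measurable
      (hp n).integrable (by simp)
  have e1 : ∀ s, ∫ x in levelSet u s, divergence (p (e s)) x = ∑ n ∈ Finset.range (N + 1),
      (e ⁻¹' {n}).indicator (fun s => ∫ x in levelSet u s, divergence (p n) x) s := fun s => by
    rw [Finset.sum_eq_single (e s)]
    · simp
    · intro n _ hn
      exact indicator_of_notMem (fun h => hn h.symm) _
    · intro h
      exact absurd (Finset.mem_range.2 (Nat.lt_succ_of_le (heN s))) h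
  simp_rw [e1]
  rw [integral_finsetSum _ fun n _ => (hFi n).integrable.indicator (hme n)]
  have e2 : ∀ n, ∫ s in Icc (0 : ℝ) 1,
      (e ⁻¹' {n}).indicator (fun s => ∫ x in levelSet u s, divergence (p n) x) s
      = ∫ x, volume.real (Icc (0 : ℝ) 1 ∩ e ⁻¹' {n} ∩ Iio (u x)) * divergence (p n) x := fun n => by
    rw [setIntegral_indicator (hme n), ← integral_slab_mul hu (hfin n) (hp n).integrable]
    rfl
  simp_rw [e2]
  refine sum_integral_comp_le (G := fun n t => volume.real (Icc (0 : ℝ) 1 ∩ e ⁻¹' {n} ∩ Iio t))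
    _ hu hu01 (fun n _ => continuous_measureReal_inter_Iio (hfin n)) (fun n _ t => ?_)
    (fun n _ => monotone_measureReal_inter_Iio (hfin n)) ?_ fun n _ => hp n
  · refine ⟨measureReal_nonneg, ?_⟩
    have := measureReal_mono (μ := volume)
      (inter_subset_left.trans inter_subset_left : Icc (0 : ℝ) 1 ∩ e ⁻¹' {n} ∩ Iio t ⊆ Icc 0 1)
      (by simp)
    simpa using this
  -- The pieces {e = n} partition the levels, so the G_n sum to |[0,1] ∩ (-∞, t)|, which grows with
  -- slope at most 1.
  · have e3 : ∀ t, ∑ n ∈ Finset.range (N + 1), volume.real (Icc (0 : ℝ) 1 ∩ e ⁻¹' {n} ∩ Iio t)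
        = volume.real (Icc (0 : ℝ) 1 ∩ Iio t) := fun t => by
      rw [← measureReal_biUnion_finset (h := fun n _ =>
        measure_ne_top_of_subset inter_subset_left (hfin n))]
      · congr 1
        ext s
        simp only [mem_iUnion, mem_inter_iff, mem_preimage, mem_singleton_iff, Finset.mem_range]
        exact ⟨fun ⟨n, _, h⟩ => ⟨h.1.1, h.2⟩,
          fun h => ⟨e s, Nat.lt_succ_of_le (heN s), ⟨h.1, rfl⟩, h.2⟩⟩
      · intro m _ n _ hmn
        exact disjoint_left.2 fun s h1 h2 => hmn (h1.1.2.symm.trans h2.1.2)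
      · exact fun n _ => (measurableSet_Icc.inter (hme n)).inter measurableSet_Iio
    simp only [e3]
    intro a b hab
    have := measureReal_inter_Iio_le (A := Icc (0 : ℝ) 1) (by simp) hab
    simp only
    linarith

theorem measurable_perimeter_levelSet {u : Plane → ℝ} (hu : Measurable u) :
    Measurable fun s => perimeter (levelSet u s) := by
  obtain ⟨p, hp, -, hper⟩ := exists_seq_perimeter_eq
  simp_rw [fun s => hper _ (measurableSet_levelSet hu s)]
  exact .iSup fun n => (measurable_setIntegral_levelSet hu
    (continuous_divergence (hp n).1).measurable).ennreal_ofReal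

/-- The difficult inequality of the coarea formula. -/
theorem lintegral_perimeter_levelSet_le_TV {u : Plane → ℝ} (hu : Measurable u)
    (hu01 : ∀ x, u x ∈ Icc (0 : ℝ) 1) :
    ∫⁻ s in Icc (0 : ℝ) 1, perimeter (levelSet u s) ≤ TV u := by
  obtain ⟨p, hp, hp0, hper⟩ := exists_seq_perimeter_eq
  have hF : ∀ n, Measurable fun s => ∫ x in levelSet u s, divergence (p n) x := fun n =>
    measurable_setIntegral_levelSet hu (continuous_divergence (hp n).1).measurable
  choose e he heN hmax using exists_measurable_argmax hF
  have hM : ∀ N, Measurable fun s => ∫ x in levelSet u s, divergence (p (e N s)) x := fun N =>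
    (measurable_from_prod_countable_right
      (f := fun z : ℕ × ℝ => ∫ x in levelSet u z.2, divergence (p z.1) x) hF).comp
        ((he N).prodMk measurable_id)
  have hsup : ∀ s, perimeter (levelSet u s)
      = ⨆ N, ENNReal.ofReal (∫ x in levelSet u s, divergence (p (e N s)) x) := fun s => by
    rw [hper _ (measurableSet_levelSet hu s)]
    refine le_antisymm (iSup_mono fun n => ENNReal.ofReal_le_ofReal (hmax n s n le_rfl))
      (iSup_le fun N => le_iSup (fun n =>
        ENNReal.ofReal (∫ x in levelSet u s, divergence (p n) x)) (e N s))
  simp_rw [hsup]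
  rw [lintegral_iSup (fun N => (hM N).ennreal_ofReal)]
  · refine iSup_le fun N => ?_
    rw [← ofReal_integral_eq_lintegral_ofReal]
    · exact integral_selection_le_TV hu hu01 hp (he N) (heN N)
    · have : IsFiniteMeasure (volume.restrict (Icc (0 : ℝ) 1)) := ⟨by simp⟩
      refine Integrable.of_bound (hM N).aestronglyMeasurable
        (∑ n ∈ Finset.range (N + 1), ∫ x, |divergence (p n) x|) (Eventually.of_forall fun s => ?_)
      refine (abs_setIntegral_levelSet_le (hp _).integrable _).trans ?_
      exact Finset.single_le_sum (f := fun n => ∫ x, |divergence (p n) x|)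
        (fun n _ => integral_nonneg fun x => abs_nonneg _)
        (Finset.mem_range.2 (Nat.lt_succ_of_le (heN N s)))
    · refine Eventually.of_forall fun s => ?_
      -- The selected field does at least as well as the zero field.
      have := hmax N s 0 (Nat.zero_le N)
      simpa [hp0, divergence_zero] using this
  · exact fun N M hNM s => ENNReal.ofReal_le_ofReal (hmax M s _ ((heN N s).trans hNM))

theorem ofReal_integral_le_lintegral_ofReal {α : Type*} [MeasurableSpace α] {μ : Measure α}
    {f : α → ℝ} (hf : Integrable f μ) :
    ENNReal.ofReal (∫ x, f x ∂μ) ≤ ∫⁻ x, ENNReal.ofReal (f x) ∂μ := by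
  rw [integral_eq_lintegral_pos_part_sub_lintegral_neg_part hf]
  refine ENNReal.ofReal_le_of_le_toReal ?_
  exact sub_le_self _ ENNReal.toReal_nonneg

/-- Convexity of TV: the pairing of an integral of layers with a test field is the integral of the
pairings. -/
theorem TV_slab_le {u : Plane → ℝ} (hu : Measurable u) {J : Set ℝ} (hJ : volume J ≠ ∞) :
    TV (slab u J) ≤ ∫⁻ s in J, perimeter (levelSet u s) := by
  refine iSup₂_le fun p hp => ?_
  rw [integral_slab_mul hu hJ hp.integrable]
  refine (ofReal_integral_le_lintegral_ofReal (integrable_setIntegral_levelSet hu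
    (continuous_divergence hp.1).measurable hp.integrable hJ)).trans (lintegral_mono fun s => ?_)
  rw [← integral_indicator_one_mul (measurableSet_levelSet hu s).nullMeasurableSet]
  exact hp.le_TV _

/-! ### Lebesgue points. -/

theorem tsub_add_tsub_eq_enorm {a b : ℝ≥0∞} (ha : a ≠ ∞) (hb : b ≠ ∞) :
    (a - b) + (b - a) = ‖a.toReal - b.toReal‖ₑ := by
  rw [Real.enorm_eq_ofReal_abs]
  rcases le_total a b with h | h
  · have h' := ENNReal.toReal_mono hb h
    rw [tsub_eq_zero_of_le h, zero_add, abs_of_nonpos (by linarith), neg_sub,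
      ENNReal.ofReal_sub _ ENNReal.toReal_nonneg, ENNReal.ofReal_toReal ha, ENNReal.ofReal_toReal hb]
  · have h' := ENNReal.toReal_mono ha h
    rw [tsub_eq_zero_of_le h, add_zero, abs_of_nonneg (by linarith),
      ENNReal.ofReal_sub _ ENNReal.toReal_nonneg, ENNReal.ofReal_toReal ha, ENNReal.ofReal_toReal hb]

theorem ae_isLebesguePoint {f : ℝ → ℝ≥0∞} (hf : Measurable f)
    (hfi : ∫⁻ s in Icc (0 : ℝ) 1, f s ≠ ∞) :
    ∀ᵐ s : ℝ, s ∈ Icc (0 : ℝ) 1 → IsLebesguePoint f s := by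
  set g : ℝ → ℝ := (Icc (0 : ℝ) 1).indicator fun s => (f s).toReal with hg
  have hgi : Integrable g :=
    IntegrableOn.integrable_indicator (integrable_toReal_of_lintegral_ne_top hf.aemeasurable hfi)
      measurableSet_Icc
  have hfin : ∀ᵐ s : ℝ, s ∈ Icc (0 : ℝ) 1 → f s < ∞ :=
    (ae_restrict_iff' measurableSet_Icc).1 (ae_lt_top hf hfi)
  have h0 : ∀ᵐ s : ℝ, s ≠ 0 := by simp [ae_iff]
  have h1 : ∀ᵐ s : ℝ, s ≠ 1 := by simp [ae_iff]
  filter_upwards [hfin, h0, h1, (Besicovitch.vitaliFamily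
    (volume : Measure ℝ)).ae_tendsto_lintegral_enorm_sub_div hgi.locallyIntegrable]
    with s hs hs0 hs1 hlim hsI
  refine ⟨hsI, (hs hsI).ne, ?_⟩
  refine (hlim.comp (Besicovitch.tendsto_filterAt volume s)).congr' ?_
  -- The endpoints form a null set; around an interior point, small windows are full balls inside
  -- [0,1].
  have hpos : 0 < min s (1 - s) := lt_min (lt_of_le_of_ne hsI.1 hs0.symm)
    (sub_pos.2 (lt_of_le_of_ne hsI.2 hs1))
  filter_upwards [Ioo_mem_nhdsGT hpos] with h hh
  have hsub : Icc (s - h) (s + h) ⊆ Icc 0 1 := Icc_subset_Icc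
    (by linarith [hh.2.trans_le (min_le_left _ _)]) (by linarith [hh.2.trans_le (min_le_right _ _)])
  rw [inter_eq_left.2 hsub, setLAverage_eq, Function.comp_apply, Real.closedBall_eq_Icc]
  congr 1
  refine setLIntegral_congr_fun_ae measurableSet_Icc ?_
  filter_upwards [hfin] with y hy hyI
  rw [tsub_add_tsub_eq_enorm (hy (hsub hyI)).ne (hs hsI).ne, hg, indicator_of_mem (hsub hyI),
    indicator_of_mem hsI]

theorem antitone_volume_levelSet (u : Plane → ℝ) : Antitone fun s => volume (levelSet u s) :=
  fun _ _ h => measure_mono fun _ hx => lt_of_le_of_lt h hx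

/-! ### Competitors built from layers, and the limit at a Lebesgue point. -/

section Minimizer

variable {Ω₀ Ω₁ : Set Plane} {u : Plane → ℝ}

theorem levelSet_ae_le (hz : ∀ᵐ x, x ∉ Ω₀ → u x = 0) {s : ℝ} (hs : 0 ≤ s) :
    ∀ᵐ x, x ∈ levelSet u s → x ∈ Ω₀ := by
  filter_upwards [hz] with x hx hxs
  by_contra h
  have : s < u x := hxs
  rw [hx h] at this
  linarith

theorem volume_levelSet_le (hz : ∀ᵐ x, x ∉ Ω₀ → u x = 0) {s : ℝ} (hs : 0 ≤ s) :
    volume (levelSet u s) ≤ volume Ω₀ := measure_mono_ae (levelSet_ae_le hz hs)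

theorem slab_eq_zero {J : Set ℝ} (hJ : J ⊆ Icc 0 1) {x : Plane} (hx : u x = 0) :
    slab u J x = 0 := by
  have : J ∩ Iio (0 : ℝ) = ∅ := by
    ext s
    simp only [mem_inter_iff, mem_Iio, mem_empty_iff_false, iff_false, not_and, not_lt]
    exact fun h => (hJ h).1
  simp [slab, hx, this]

theorem volume_ne_top_of_subset_Icc {J : Set ℝ} (hJ : J ⊆ Icc 0 1) : volume J ≠ ∞ :=
  measure_ne_top_of_subset hJ (by simp)

/-- The constant 1 is not integrable on the plane; this indicator replaces it when
`integral_slab_mul` is used to compute the integral of a layer. -/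
theorem slab_mul_indicator_ae (hz : ∀ᵐ x, x ∉ Ω₀ → u x = 0) {J : Set ℝ} (hJ : J ⊆ Icc 0 1) :
    (fun x => slab u J x * (toMeasurable volume Ω₀).indicator 1 x) =ᵐ[volume] slab u J := by
  filter_upwards [hz] with x hx
  by_cases h : x ∈ toMeasurable volume Ω₀
  · simp [h]
  · simp [h, slab_eq_zero hJ (hx fun h' => h (subset_toMeasurable _ _ h'))]

theorem integrable_indicator_toMeasurable (hfin : volume Ω₀ ≠ ∞) :
    Integrable ((toMeasurable volume Ω₀).indicator (1 : Plane → ℝ)) :=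
  (integrable_indicator_iff (measurableSet_toMeasurable _ _)).2
    (integrableOn_const (by rwa [measure_toMeasurable]) (by simp))

theorem integrable_slab (hu : Measurable u) (hfin : volume Ω₀ ≠ ∞)
    (hz : ∀ᵐ x, x ∉ Ω₀ → u x = 0) {J : Set ℝ} (hJ : J ⊆ Icc 0 1) : Integrable (slab u J) := by
  have hJf := volume_ne_top_of_subset_Icc hJ
  refine Integrable.congr ?_ (slab_mul_indicator_ae hz hJ)
  refine (integrable_indicator_toMeasurable hfin).bdd_mul (c := volume.real J)
    (measurable_slab hu hJf).aestronglyMeasurable (Eventually.of_forall fun x => ?_)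
  rw [slab, Real.norm_of_nonneg measureReal_nonneg]
  exact measureReal_mono inter_subset_left hJf

theorem integral_slab (hu : Measurable u) (hfin : volume Ω₀ ≠ ∞)
    (hz : ∀ᵐ x, x ∉ Ω₀ → u x = 0) {J : Set ℝ} (hJm : MeasurableSet J) (hJ : J ⊆ Icc 0 1) :
    ∫ x, slab u J x = ∫ s in J, (volume (levelSet u s)).toReal := by
  rw [← integral_congr_ae (slab_mul_indicator_ae hz hJ),
    integral_slab_mul hu (volume_ne_top_of_subset_Icc hJ) (integrable_indicator_toMeasurable hfin)]
  refine setIntegral_congr_fun hJm fun s hs => ?_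
  have hW := measurableSet_toMeasurable volume Ω₀
  rw [setIntegral_indicator hW]
  have : (levelSet u s ∩ toMeasurable volume Ω₀ : Set Plane) =ᵐ[volume] levelSet u s := by
    filter_upwards [levelSet_ae_le hz (hJ hs).1] with x hx
    exact propext ⟨fun h => h.1, fun h => ⟨h, subset_toMeasurable _ _ (hx h)⟩⟩
  rw [setIntegral_congr_set this]
  simp [measureReal_def]

theorem slab_Icc {x : Plane} (hx : u x ∈ Icc (0 : ℝ) 1) : slab u (Icc 0 1) x = u x := by
  have : (Icc (0 : ℝ) 1 ∩ Iio (u x)) = Ico 0 (u x) := by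
    ext s
    simp only [mem_inter_iff, mem_Icc, mem_Iio, mem_Ico]
    exact ⟨fun h => ⟨h.1.1, h.2⟩, fun h => ⟨⟨h.1, h.2.le.trans hx.2⟩, h.2⟩⟩
  rw [slab, this, Real.volume_real_Ico_of_le hx.1, sub_zero]

theorem slab_diff {I : Set ℝ} (hIm : MeasurableSet I) (hI : I ⊆ Icc 0 1) {x : Plane}
    (hx : u x ∈ Icc (0 : ℝ) 1) : slab u (Icc 0 1 \ I) x = u x - slab u I x := by
  have h := slab_Icc hx
  rw [← h]
  have hd : (Icc (0 : ℝ) 1 ∩ Iio (u x)) \ (I ∩ Iio (u x)) = (Icc 0 1 \ I) ∩ Iio (u x) := by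
    ext s
    simp only [Set.mem_sdiff, mem_inter_iff]
    tauto
  rw [slab, slab, slab, ← hd, measureReal_sdiff (inter_subset_inter_left _ hI)
    (hIm.inter measurableSet_Iio) (volume_ne_top_of_subset_Icc inter_subset_left)]

theorem slab_of_eq_one {I : Set ℝ} (hI : I ⊆ Icc 0 1) {x : Plane} (hx : u x = 1) :
    slab u I x = volume.real I := by
  rw [slab, hx]
  refine measureReal_congr ?_
  have h1 : ∀ᵐ s : ℝ, s ≠ 1 := by simp [ae_iff]
  filter_upwards [h1] with s hs
  exact propext ⟨fun h => h.1, fun h => ⟨h, lt_of_le_of_ne (hI h).2 hs⟩⟩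

theorem integrableOn_volume_levelSet (hfin : volume Ω₀ ≠ ∞)
    (hz : ∀ᵐ x, x ∉ Ω₀ → u x = 0) {J : Set ℝ} (hJm : MeasurableSet J) (hJ : J ⊆ Icc 0 1) :
    IntegrableOn (fun s => (volume (levelSet u s)).toReal) J := by
  refine IntegrableOn.of_bound (volume_ne_top_of_subset_Icc hJ).lt_top
    (antitone_volume_levelSet u).measurable.ennreal_toReal.aestronglyMeasurable
    (volume Ω₀).toReal ?_
  refine (ae_restrict_iff' hJm).2 (Eventually.of_forall fun s hs => ?_)
  rw [Real.norm_of_nonneg ENNReal.toReal_nonneg]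
  exact ENNReal.toReal_mono hfin (volume_levelSet_le hz (hJ hs).1)

/-- Replacing the layers of a minimizer at levels in `I` by a competitor `v`, with a multiple of
`w` to restore the integral, does not decrease the total variation. -/
theorem lintegral_perimeter_le {ν : ℝ} (hum : Measurable u) (hu01 : ∀ x, u x ∈ Icc (0 : ℝ) 1)
    (hfin : volume Ω₀ ≠ ∞) (hu : MinimizesTV (admissible Ω₀ Ω₁ ν) u)
    {I : Set ℝ} (hIm : MeasurableSet I) (hI : I ⊆ Icc 0 1) {b : ℝ} {v w : Plane → ℝ}
    (hv : v ∈ admissible Ω₀ Ω₁ b) (hw : IsBV w) (hw0 : ∀ᵐ x, x ∉ Ω₀ → w x = 0)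
    (hw1 : ∀ᵐ x, x ∈ Ω₁ → w x = 0) {c : ℝ}
    (hc : c * ∫ x, w x = ∫ s in I, ((volume (levelSet u s)).toReal - b)) :
    ∫⁻ s in I, perimeter (levelSet u s) ≤ volume I * TV v + ENNReal.ofReal |c| * TV w := by
  obtain ⟨⟨hui, hutv⟩, hz, ho, hint⟩ := hu.1
  have hIf := volume_ne_top_of_subset_Icc hI
  set J := Icc (0 : ℝ) 1 \ I with hJ
  have hJm : MeasurableSet J := measurableSet_Icc.diff hIm
  have hJs : J ⊆ Icc 0 1 := sdiff_subset
  have hJf := volume_ne_top_of_subset_Icc hJs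
  have hsi := integrable_slab hum hfin hz hJs
  have hvi : Integrable fun x => volume.real I * v x := hv.1.1.const_mul _
  have hwi : Integrable fun x => c * w x := hw.1.const_mul _
  have hvw : Integrable fun x => volume.real I * v x + c * w x := hvi.add hwi
  -- On Ω₁ its value is (1 - |I|) + |I| + 0 = 1, and `hc` is exactly the condition that its integral
  -- is ν.
  set U : Plane → ℝ := fun x => slab u J x + (volume.real I * v x + c * w x) with hU
  have hcoarea := lintegral_perimeter_levelSet_le_TV hum hu01
  have hsplit : ∫⁻ s in Icc (0 : ℝ) 1, perimeter (levelSet u s)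
      = (∫⁻ s in J, perimeter (levelSet u s)) + ∫⁻ s in I, perimeter (levelSet u s) := by
    rw [← lintegral_union hIm disjoint_sdiff_left, sdiff_union_of_subset hI]
  -- Finiteness allows this term to be cancelled from both sides at the end.
  have hPJ : ∫⁻ s in J, perimeter (levelSet u s) ≠ ∞ :=
    ((le_self_add.trans hsplit.ge).trans_lt (hcoarea.trans_lt hutv)).ne
  have hTVU : TV U ≤ (∫⁻ s in J, perimeter (levelSet u s))
      + (volume I * TV v + ENNReal.ofReal |c| * TV w) := by
    refine (TV_add_le hsi hvw).trans (add_le_add (TV_slab_le hum hJf)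
      ((TV_add_le hvi hwi).trans (add_le_add ?_ (TV_const_mul_le _ _))))
    refine (TV_const_mul_le _ _).trans_eq ?_
    rw [abs_of_nonneg measureReal_nonneg, ofReal_measureReal hIf]
  have hfinite : volume I * TV v + ENNReal.ofReal |c| * TV w < ∞ :=
    ENNReal.add_lt_top.2 ⟨ENNReal.mul_lt_top hIf.lt_top hv.1.2,
      ENNReal.mul_lt_top ENNReal.ofReal_lt_top hw.2⟩
  have hUA : U ∈ admissible Ω₀ Ω₁ ν := by
    refine ⟨⟨hsi.add hvw, hTVU.trans_lt (ENNReal.add_lt_top.2 ⟨hPJ.lt_top, hfinite⟩)⟩, ?_, ?_, ?_⟩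
    · filter_upwards [hz, hv.2.1, hw0] with x h1 h2 h3 hx
      simp [hU, slab_eq_zero hJs (h1 hx), h2 hx, h3 hx]
    · filter_upwards [ho, hv.2.2.1, hw1] with x h1 h2 h3 hx
      simp only [hU]
      rw [slab_diff hIm hI (hu01 x), slab_of_eq_one hI (h1 hx), h1 hx, h2 hx, h3 hx]
      ring
    · have hbI := integrableOn_volume_levelSet hfin hz hIm hI
      have hbJ := integrableOn_volume_levelSet hfin hz hJm hJs
      have hu' : ∫ s in Icc (0 : ℝ) 1, (volume (levelSet u s)).toReal = ν := by
        rw [← integral_slab hum hfin hz measurableSet_Icc subset_rfl, ← hint]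
        exact integral_congr_ae (Eventually.of_forall fun x => slab_Icc (hu01 x))
      rw [← sdiff_union_of_subset hI, setIntegral_union disjoint_sdiff_left hIm hbJ hbI] at hu'
      simp only [hU]
      rw [integral_add hsi hvw, integral_add hvi hwi, integral_const_mul, integral_const_mul, hc,
        hv.2.2.2, integral_slab hum hfin hz hJm hJs,
        integral_sub hbI (integrableOn_const hIf (by simp)), setIntegral_const, smul_eq_mul]
      linarith
  have hmin : TV u ≤ TV U := hu.2 hUA
  have := (hsplit.symm.le.trans hcoarea).trans (hmin.trans hTVU)
  exact (ENNReal.add_le_add_iff_left hPJ).1 this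

theorem indicator_levelSet_mem_admissible (hum : Measurable u)
    (hz : ∀ᵐ x, x ∉ Ω₀ → u x = 0) (hfin : volume Ω₀ ≠ ∞) {t : ℝ} (ht : 0 ≤ t)
    (h1 : ∀ᵐ x, x ∈ Ω₁ → t < u x) (hper : perimeter (levelSet u t) ≠ ∞) :
    (levelSet u t).indicator 1 ∈ admissible Ω₀ Ω₁ (volume (levelSet u t)).toReal := by
  have hm := measurableSet_levelSet hum t
  refine ⟨⟨(integrable_indicator_iff hm).2 (integrableOn_const
    ((volume_levelSet_le hz ht).trans_lt hfin.lt_top).ne (by simp)), hper.lt_top⟩, ?_, ?_, ?_⟩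
  · filter_upwards [levelSet_ae_le hz ht] with x hx hxΩ
    exact indicator_of_notMem (fun h => hxΩ (hx h)) _
  · filter_upwards [h1] with x hx hxΩ
    rw [indicator_of_mem (show x ∈ levelSet u t from hx hxΩ), Pi.one_apply]
  · rw [integral_indicator_one hm, measureReal_def]

theorem exists_lintegral_perimeter_le {ν : ℝ} (hum : Measurable u)
    (hu01 : ∀ x, u x ∈ Icc (0 : ℝ) 1)
    (hfin : volume Ω₀ ≠ ∞) (hu : MinimizesTV (admissible Ω₀ Ω₁ ν) u) {B : ℝ≥0∞} (hB : B ≠ ∞)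
    {v : Plane → ℝ} (hv : v ∈ admissible Ω₀ Ω₁ B.toReal) :
    ∃ K : ℝ≥0∞, K ≠ ∞ ∧ ∀ I : Set ℝ, MeasurableSet I → I ⊆ Icc 0 1 →
      ∫⁻ s in I, perimeter (levelSet u s) ≤ volume I * TV v
        + K * ∫⁻ s in I, ((volume (levelSet u s) - B) + (B - volume (levelSet u s))) := by
  obtain ⟨⟨hui, hutv⟩, hz, ho, hint⟩ := hu.1
  -- If almost every layer has area B, the integral needs no repair: w = 0 and c = 0.
  by_cases hconst : ∀ᵐ s : ℝ, s ∈ Icc (0 : ℝ) 1 → volume (levelSet u s) = B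
  · refine ⟨0, ENNReal.zero_ne_top, fun I hIm hI => ?_⟩
    have h0 : IsBV (0 : Plane → ℝ) := ⟨integrable_zero _ _ _, by simp [TV]⟩
    have := lintegral_perimeter_le hum hu01 hfin hu hIm hI hv h0 (by simp) (by simp) (c := 0) ?_
    · simpa using this
    · rw [zero_mul, eq_comm]
      refine integral_eq_zero_of_ae ((ae_restrict_iff' hIm).2 ?_)
      filter_upwards [hconst] with s hs hsI
      simp [hs (hI hsI)]
  -- Almost every level is below 1 and has finite perimeter, so failure at all such t would give
  -- `hconst`. The condition t ≠ 1 makes E_t contain Ω₁ up to a null set.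
  · obtain ⟨t, ht, ht1, hper, htB⟩ : ∃ t ∈ Icc (0 : ℝ) 1, t ≠ 1 ∧
        perimeter (levelSet u t) ≠ ∞ ∧ volume (levelSet u t) ≠ B := by
      by_contra hne
      push Not at hne
      refine hconst ?_
      have h1 : ∀ᵐ s : ℝ, s ≠ 1 := by simp [ae_iff]
      have h2 := (ae_restrict_iff' measurableSet_Icc).1 (ae_lt_top
        (measurable_perimeter_levelSet hum)
        ((lintegral_perimeter_levelSet_le_TV hum hu01).trans_lt hutv).ne)
      filter_upwards [h1, h2] with s hs1 hs2 hsI using hne s hsI hs1 (hs2 hsI).ne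
    have hE := indicator_levelSet_mem_admissible (Ω₁ := Ω₁) hum hz hfin ht.1 (by
      filter_upwards [ho] with x hx hxΩ
      rw [hx hxΩ]
      exact lt_of_le_of_ne ht.2 ht1) hper
    set w : Plane → ℝ := fun x => (levelSet u t).indicator 1 x + (-1) * v x with hwdef
    have hw : IsBV w := by
      refine ⟨hE.1.1.add (hv.1.1.const_mul _), (TV_add_le hE.1.1 (hv.1.1.const_mul _)).trans_lt
        (ENNReal.add_lt_top.2 ⟨hE.1.2, (TV_const_mul_le _ _).trans_lt
          (ENNReal.mul_lt_top ENNReal.ofReal_lt_top hv.1.2)⟩)⟩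
    have hwint : ∫ x, w x ≠ 0 := by
      simp only [hwdef]
      rw [integral_add hE.1.1 (hv.1.1.const_mul _), integral_const_mul, hE.2.2.2, hv.2.2.2]
      intro h
      refine htB ((ENNReal.toReal_eq_toReal_iff'
        ((volume_levelSet_le hz ht.1).trans_lt hfin.lt_top).ne hB).1 (by linarith))
    -- Here c = (∫_I (|E_s| - B) ds) / ∫ w, so |c| TV(w) is bounded with K = TV(w) / |∫ w|, whatever
    -- I is.
    refine ⟨ENNReal.ofReal |∫ x, w x|⁻¹ * TV w, ENNReal.mul_ne_top ENNReal.ofReal_ne_top hw.2.ne,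
      fun I hIm hI => ?_⟩
    refine (lintegral_perimeter_le hum hu01 hfin hu hIm hI hv hw ?_ ?_
      (div_mul_cancel₀ _ hwint)).trans ?_
    · filter_upwards [hE.2.1, hv.2.1] with x h1 h2 hx
      simp [hwdef, h1 hx, h2 hx]
    · filter_upwards [hE.2.2.1, hv.2.2.1] with x h1 h2 hx
      simp [hwdef, h1 hx, h2 hx]
    · refine add_le_add le_rfl ?_
      rw [abs_div, div_eq_inv_mul, ENNReal.ofReal_mul (by positivity), mul_right_comm]
      gcongr
      rw [← Real.enorm_eq_ofReal_abs]
      refine (enorm_integral_le_lintegral_enorm _).trans_eq (setLIntegral_congr_fun hIm fun s hs => ?_)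
      exact (tsub_add_tsub_eq_enorm
        ((volume_levelSet_le hz (hI hs).1).trans_lt hfin.lt_top).ne hB).symm

theorem volume_window_ne_zero {s₀ h : ℝ} (hs : s₀ ∈ Icc (0 : ℝ) 1) (hh : 0 < h) :
    volume (Icc (s₀ - h) (s₀ + h) ∩ Icc (0 : ℝ) 1) ≠ 0 := by
  rw [Icc_inter_Icc, Real.volume_Icc]
  simp only [ne_eq, ENNReal.ofReal_eq_zero, not_le, sub_pos]
  rcases hs.1.eq_or_lt with h0 | h0
  · exact max_lt (lt_min (by linarith) (by linarith)) (lt_min (by linarith) (by linarith))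
  · exact max_lt (lt_min (by linarith) (by linarith [hs.2])) (lt_min (by linarith) one_pos)

/-- Only s₀ = 1 is delicate. There E_1 is empty while |E_s| ≥ |Ω₁| for s < 1, so 1 can be a Lebesgue
point of the area only if Ω₁ is null. -/
theorem lt_of_isLebesguePoint (hu01 : ∀ x, u x ∈ Icc (0 : ℝ) 1)
    (ho : ∀ᵐ x, x ∈ Ω₁ → u x = 1) {s₀ : ℝ}
    (hL : IsLebesguePoint (fun t => volume (levelSet u t)) s₀) : ∀ᵐ x, x ∈ Ω₁ → s₀ < u x := by
  rcases hL.1.2.lt_or_eq with h | rfl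
  · filter_upwards [ho] with x hx hxΩ
    rwa [hx hxΩ]
  · have hE : volume (levelSet u 1) = 0 := by
      have : levelSet u 1 = ∅ := by
        ext x
        simpa [levelSet] using (hu01 x).2
      rw [this, measure_empty]
    have hzero : volume Ω₁ ≤ 0 := by
      refine ge_of_tendsto hL.2.2 ?_
      filter_upwards [self_mem_nhdsWithin] with h hh
      set I := Icc (1 - h) (1 + h) ∩ Icc (0 : ℝ) 1 with hI
      have hI0 : volume I ≠ 0 := volume_window_ne_zero hL.1 hh
      have hIf : volume I ≠ ∞ := volume_ne_top_of_subset_Icc inter_subset_right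
      rw [setLAverage_eq, ENNReal.le_div_iff_mul_le (Or.inl hI0) (Or.inl hIf), ← setLIntegral_const]
      refine lintegral_mono_ae ((ae_restrict_iff' (measurableSet_Icc.inter measurableSet_Icc)).2 ?_)
      have h1 : ∀ᵐ s : ℝ, s ≠ 1 := by simp [ae_iff]
      filter_upwards [h1] with s hs hsI
      rw [hE, tsub_zero, zero_tsub, add_zero]
      refine measure_mono_ae ?_
      filter_upwards [ho] with x hx hxΩ
      change s < u x
      rw [hx hxΩ]
      exact lt_of_le_of_ne hsI.2.2 hs
    filter_upwards [measure_eq_zero_iff_ae_notMem.1 (le_zero_iff.1 hzero)] with x hx hxΩ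
    exact absurd hxΩ hx

theorem perimeter_le_TV_of_isLebesguePoint {ν : ℝ} (hum : Measurable u)
    (hu01 : ∀ x, u x ∈ Icc (0 : ℝ) 1)
    (hfin : volume Ω₀ ≠ ∞) (hu : MinimizesTV (admissible Ω₀ Ω₁ ν) u) {s₀ : ℝ}
    (hP : IsLebesguePoint (fun t => perimeter (levelSet u t)) s₀)
    (hL : IsLebesguePoint (fun t => volume (levelSet u t)) s₀) {v : Plane → ℝ}
    (hv : v ∈ admissible Ω₀ Ω₁ (volume (levelSet u s₀)).toReal) :
    perimeter (levelSet u s₀) ≤ TV v := by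
  obtain ⟨K, hK, hle⟩ := exists_lintegral_perimeter_le hum hu01 hfin hu hL.2.1 hv
  have hlim := (tendsto_const_nhds (x := TV v)).add
    ((ENNReal.Tendsto.const_mul hL.2.2 (Or.inr hK)).add hP.2.2)
  rw [mul_zero, add_zero, add_zero] at hlim
  refine ge_of_tendsto hlim ?_
  filter_upwards [self_mem_nhdsWithin] with h hh
  set I := Icc (s₀ - h) (s₀ + h) ∩ Icc (0 : ℝ) 1 with hI
  have hI0 : volume I ≠ 0 := volume_window_ne_zero hL.1 hh
  have hIf : volume I ≠ ∞ := volume_ne_top_of_subset_Icc inter_subset_right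
  have hpm := measurable_perimeter_levelSet hum
  -- Per(E_{s₀}) ≤ Per(E_s) + |Per(E_s) - Per(E_{s₀})|, integrated over the window.
  have h1 : perimeter (levelSet u s₀) * volume I ≤ (∫⁻ s in I, perimeter (levelSet u s))
      + ∫⁻ s in I, ((perimeter (levelSet u s) - perimeter (levelSet u s₀))
        + (perimeter (levelSet u s₀) - perimeter (levelSet u s))) := by
    rw [← lintegral_add_left hpm, ← setLIntegral_const]
    refine lintegral_mono fun s => ?_
    calc perimeter (levelSet u s₀)
        ≤ perimeter (levelSet u s) + (perimeter (levelSet u s₀) - perimeter (levelSet u s)) :=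
          le_add_tsub
      _ ≤ _ := by gcongr; exact le_add_self
  have h2 := h1.trans (add_le_add_left (hle I (measurableSet_Icc.inter measurableSet_Icc)
    inter_subset_right) _)
  rw [← ENNReal.le_div_iff_mul_le (Or.inl hI0) (Or.inl hIf)] at h2
  refine h2.trans_eq ?_
  rw [setLAverage_eq, setLAverage_eq, ENNReal.add_div, ENNReal.add_div, mul_comm (volume I),
    ENNReal.mul_div_cancel_right hI0 hIf, mul_div_assoc, add_assoc]

end Minimizer

/-! ### Independence of the representative. -/

theorem levelSet_ae_eq {u u' : Plane → ℝ} (h : u =ᵐ[volume] u') (s : ℝ) :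
    levelSet u s =ᵐ[volume] levelSet u' s := by
  filter_upwards [h] with x hx
  exact propext (by change s < u x ↔ s < u' x; rw [hx])

theorem mem_admissible_congr_ae {Ω₀ Ω₁ : Set Plane} {ν : ℝ} {f g : Plane → ℝ}
    (h : f =ᵐ[volume] g) (hf : f ∈ admissible Ω₀ Ω₁ ν) : g ∈ admissible Ω₀ Ω₁ ν := by
  refine ⟨⟨hf.1.1.congr h, TV_congr_ae h ▸ hf.1.2⟩, ?_, ?_, integral_congr_ae h ▸ hf.2.2.2⟩
  · filter_upwards [h, hf.2.1] with x hx h0 hxΩ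
    rw [← hx, h0 hxΩ]
  · filter_upwards [h, hf.2.2.1] with x hx h1 hxΩ
    rw [← hx, h1 hxΩ]

theorem MinimizesTV.congr_ae {Ω₀ Ω₁ : Set Plane} {ν : ℝ} {f g : Plane → ℝ}
    (h : f =ᵐ[volume] g) (hf : MinimizesTV (admissible Ω₀ Ω₁ ν) f) :
    MinimizesTV (admissible Ω₀ Ω₁ ν) g :=
  ⟨mem_admissible_congr_ae h hf.1, fun v hv => by
    change TV g ≤ TV v
    rw [← TV_congr_ae h]
    exact hf.2 hv⟩

theorem exists_measurable_mem_Icc_ae_eq {u : Plane → ℝ} (hu : AEStronglyMeasurable u volume)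
    (hu01 : ∀ᵐ x, u x ∈ Icc (0 : ℝ) 1) :
    ∃ u' : Plane → ℝ, Measurable u' ∧ (∀ x, u' x ∈ Icc (0 : ℝ) 1) ∧ u =ᵐ[volume] u' := by
  refine ⟨fun x => max 0 (min 1 (hu.mk u x)),
    measurable_const.max (measurable_const.min hu.stronglyMeasurable_mk.measurable),
    fun x => ⟨le_max_left _ _, max_le zero_le_one (min_le_left _ _)⟩, ?_⟩
  filter_upwards [hu.ae_eq_mk, hu01] with x hx hx01
  rw [← hx, min_eq_right hx01.2, max_eq_right hx01.1]

end TVMin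

theorem mainTheorem6 (Ω₀ Ω₁ : Set TVMin.Plane)
    (hΩ₀ : NullMeasurableSet Ω₀ volume) (hΩ₁ : NullMeasurableSet Ω₁ volume)
    (hb : Bornology.IsBounded Ω₀) (hsub : Ω₁ ⊆ Ω₀)
    (ν : ℝ) (u : TVMin.Plane → ℝ)
    (hu : TVMin.MinimizesTV (TVMin.admissible Ω₀ Ω₁ ν) u)
    (hu01 : ∀ᵐ x, u x ∈ Icc (0 : ℝ) 1) :
    Measurable (fun s : Icc (0 : ℝ) 1 => TVMin.perimeter (TVMin.levelSet u s)) ∧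
    Measurable (fun s : Icc (0 : ℝ) 1 => volume (TVMin.levelSet u s)) ∧
    (∀ᵐ s : ℝ, s ∈ Icc (0 : ℝ) 1 →
      TVMin.IsLebesguePoint (fun t => TVMin.perimeter (TVMin.levelSet u t)) s ∧
      TVMin.IsLebesguePoint (fun t => volume (TVMin.levelSet u t)) s) ∧
    ∀ s₀ : ℝ,
      TVMin.IsLebesguePoint (fun t => TVMin.perimeter (TVMin.levelSet u t)) s₀ →
      TVMin.IsLebesguePoint (fun t => volume (TVMin.levelSet u t)) s₀ →
      TVMin.MinimizesTV
        (TVMin.admissible Ω₀ Ω₁ (volume (TVMin.levelSet u s₀)).toReal)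
        ((TVMin.levelSet u s₀).indicator 1) := by
  -- Passing to a measurable representative with values everywhere in [0,1] changes each E_s, for
  -- every s, only by a null set; areas and perimeters stay the same.
  obtain ⟨u', hum, hu01', hae⟩ :=
    TVMin.exists_measurable_mem_Icc_ae_eq hu.1.1.1.aestronglyMeasurable hu01
  have hu' := hu.congr_ae hae
  have hfin : volume Ω₀ ≠ ∞ := hb.measure_lt_top.ne
  have hlev := fun s => TVMin.levelSet_ae_eq hae s
  have hz := hu'.1.2.1
  simp_rw [fun s => TVMin.perimeter_congr_ae (hlev s), fun s => measure_congr (hlev s)]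
  have hPm := TVMin.measurable_perimeter_levelSet hum
  have hVm := (TVMin.antitone_volume_levelSet u').measurable
  have hPi := ((TVMin.lintegral_perimeter_levelSet_le_TV hum hu01').trans_lt hu'.1.1.2).ne
  have hVi : ∫⁻ s in Icc (0 : ℝ) 1, volume (TVMin.levelSet u' s) ≠ ∞ := by
    refine ((setLIntegral_mono' measurableSet_Icc fun s hs =>
      TVMin.volume_levelSet_le hz hs.1).trans_lt ?_).ne
    simpa using hfin.lt_top
  refine ⟨hPm.comp measurable_subtype_coe, hVm.comp measurable_subtype_coe, ?_,
    fun s₀ hP hV => ?_⟩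
  · filter_upwards [TVMin.ae_isLebesguePoint hPm hPi, TVMin.ae_isLebesguePoint hVm hVi]
      with s h1 h2 hs using ⟨h1 hs, h2 hs⟩
  · have hmin : TVMin.MinimizesTV
        (TVMin.admissible Ω₀ Ω₁ (volume (TVMin.levelSet u' s₀)).toReal)
        ((TVMin.levelSet u' s₀).indicator 1) :=
      ⟨TVMin.indicator_levelSet_mem_admissible hum hz hfin hP.1.1
        (TVMin.lt_of_isLebesguePoint hu01' hu'.1.2.2.1 hV) hP.2.1,
        fun v hv => TVMin.perimeter_le_TV_of_isLebesguePoint hum hu01' hfin hu' hP hV hv⟩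
    exact hmin.congr_ae (indicator_ae_eq_of_ae_eq_set (hlev s₀).symm)
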